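/- **Definitions.** A *partially ordered commutative ring* is a pair $(R,\mathcal P)$ where $R$ is a commutative ring with $1\neq 0$ and $\mathcal P\subseteq R$ (the *nonnegative* elements) contains $0$ and $1$, is closed under addition and multiplication, and satisfies $\mathcal P\cap(-\mathcal P)=\{0\}$. A polynomial ring $R[x,y]$ or $R[y]$ carries the *coefficientwise order*: a polynomial is nonnegative iff all its coefficients lie in $\mathcal P$. For $1\le r\le\infty$, a matrix with entries in a partially ordered commutative ring is *totally positive of order $r$* (TP$_r$) if all its minors of size $\le r$ are nonnegative. A sequence $(a_n)_{n\ge 0}$ is *Hankel-TP$_r$* if the matrix $(a_{i+j})_{i,j\ge 0}$ is TP$_r$, and *Toeplitz-TP$_r$* if the matrix $(a_{i-j})_{i,j\ge 0}$, with $a_n=0$ for $n<0$, is TP$_r$. For matrices and sequences of polynomials, the word *coefficientwise* means that these notions refer to the coefficientwise order. Consider forests of rooted trees on the vertex set $[n]=\{1,\dots,n\}$. Let $ij$ be an edge with $j$ a child of $i$. It is *improper* if some descendant of $j$ (possibly $j$ itself) is lower-numbered than $i$; otherwise it is *proper* and $j$ is a *proper child* of $i$. For a sequence $\phi=(\phi_m)_{m\ge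 0}$ in $R$, let $f_{n,k}(y,\phi)\in R[y]$ be the generating polynomial of the $k$-component forests of rooted trees on $[n]$, with a weight $y$ for each improper edge and a weight $m!\,\phi_m$ for each vertex with $m$ proper children. Define, in $R[x,y]$, $$F_n(x,y,\phi)=\sum_{\ell=0}^n f_{n,\ell}(y,\phi)\,x^\ell,\qquad F_{n,k}(x,y,\phi)=\sum_{\ell=k}^n f_{n,\ell}(y,\phi)\binom{\ell}{k}x^{\ell-k}.$$ **Theorem 1.4.** Fix $1\le r\le\infty$. Let $R$ be a partially ordered commutative ring, and let $\phi=(\phi_m)_{m\ge 0}$ be a sequence in $R$ that is Toeplitz-totally positive of order $r$. Then: (a) The lower-triangular polynomial matrix $\bigl(F_{n,k}(x,y,\phi)\bigr)_{n,k\ge 0}$ is coefficientwise totally positive of order $r$ (jointly in $x,y$). (b) The polynomial sequence $\bigl(F_n(x,y,\phi)\bigr)_{n\ge 0}$ is coefficientwise Hankel-totally positive of order $r$ (jointly in $x,y$). (c) The polynomial sequence $\bigl(f_{n+1,1}(y,\phi)\bigr)_{n\ge 0}$ is coefficientwise Hankel-totally positive of order $r$ (in $y$). -/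

import Mathlib

/-! ### Total positivity in a partially ordered commutative ring

A partially ordered commutative ring is a pair `(R, P)` of a commutative ring `R` and a set `P` of
"nonnegative" elements with `0, 1 ∈ P`, closed under sums and products, and `P ∩ (-P) = {0}`.
This is exactly `P : RingCone R`. -/

/-- The coefficientwise order on `R[y]`: a polynomial is nonnegative
iff all its coefficients are nonnegative. -/
def RingCone.polynomial {R : Type*} [CommRing R] (P : RingCone R) :
    RingCone (Polynomial R) where
  carrier := {p | ∀ i, p.coeff i ∈ P}
  zero_mem' := fun i => by simp [zero_mem P]
  one_mem' := fun i => by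
    rw [Polynomial.coeff_one]
    split_ifs
    · exact one_mem P
    · exact zero_mem P
  add_mem' := fun {p q} hp hq i => by
    rw [Polynomial.coeff_add]
    exact add_mem (hp i) (hq i)
  mul_mem' := fun {p q} hp hq i => by
    rw [Polynomial.coeff_mul]
    exact sum_mem fun c _ => mul_mem (hp c.1) (hq c.2)
  eq_zero_of_mem_of_neg_mem' := fun {p} hp hq => by
    ext i
    refine eq_zero_of_mem_of_neg_mem (hp i) ?_
    simpa using hq i

/-- The coefficientwise order on the polynomial ring `R[x_i : i ∈ σ]` in several indeterminates. -/
def RingCone.mvPolynomial {R : Type*} [CommRing R] (σ : Type*) (P : RingCone R) :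
    RingCone (MvPolynomial σ R) where
  carrier := {p | ∀ d, p.coeff d ∈ P}
  zero_mem' := fun d => by simp [zero_mem P]
  one_mem' := fun d => by
    classical
    rw [MvPolynomial.coeff_one]
    split_ifs
    · exact one_mem P
    · exact zero_mem P
  add_mem' := fun {p q} hp hq d => by
    rw [MvPolynomial.coeff_add]
    exact add_mem (hp d) (hq d)
  mul_mem' := fun {p q} hp hq d => by
    classical
    rw [MvPolynomial.coeff_mul]
    exact sum_mem fun c _ => mul_mem (hp c.1) (hq c.2)
  eq_zero_of_mem_of_neg_mem' := fun {p} hp hq => by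
    ext d
    refine eq_zero_of_mem_of_neg_mem (hp d) ?_
    simpa using hq d

/-- An infinite matrix with entries in the partially ordered ring `(R, P)` is totally positive of
order `r` (`1 ≤ r ≤ ∞`) if all its minors of size `≤ r` are nonnegative; `r = ⊤` is total
positivity. -/
def IsTPOfOrder {R : Type*} [CommRing R] (P : RingCone R) (r : ℕ∞) (A : Matrix ℕ ℕ R) : Prop :=
  ∀ s : ℕ, (s : ℕ∞) ≤ r → ∀ rows cols : Fin s → ℕ, StrictMono rows → StrictMono cols →
    (A.submatrix rows cols).det ∈ P

/-- The infinite Hankel matrix `(a_{i+j})_{i,j ≥ 0}`. -/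
def hankelMatrix {R : Type*} (a : ℕ → R) : Matrix ℕ ℕ R :=
  Matrix.of fun i j => a (i + j)

/-- The infinite Toeplitz matrix `(a_{i-j})_{i,j ≥ 0}`, where `a_n = 0` for `n < 0`. -/
def toeplitzMatrix {R : Type*} [Zero R] (a : ℕ → R) : Matrix ℕ ℕ R :=
  Matrix.of fun i j => if j ≤ i then a (i - j) else 0

/-- The sequence `a` is Hankel-totally positive of order `r`. -/
def IsHankelTPOfOrder {R : Type*} [CommRing R] (P : RingCone R) (r : ℕ∞) (a : ℕ → R) : Prop :=
  IsTPOfOrder P r (hankelMatrix a)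

/-- The sequence `a` is Toeplitz-totally positive of order `r`. -/
def IsToeplitzTPOfOrder {R : Type*} [CommRing R] (P : RingCone R) (r : ℕ∞) (a : ℕ → R) : Prop :=
  IsTPOfOrder P r (toeplitzMatrix a)

/-! ### Forests of rooted trees -/

/-- A forest of rooted trees on the finite vertex set `V`, given by its parent function
(`none` for the roots); there is no directed cycle. -/
@[ext]
structure RootedForest (V : Type*) where
  /-- The parent of a vertex, or `none` if the vertex is a root. -/
  parent : V → Option V
  /-- No vertex is reached from itself by one or more parent-to-child steps. -/
  acyclic : ∀ v, ¬ Relation.TransGen (fun i j => parent j = some i) v v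

namespace RootedForest

noncomputable instance {V : Type*} [Fintype V] : Fintype (RootedForest V) := by
  classical
  exact Fintype.ofInjective RootedForest.parent fun _ _ h => RootedForest.ext h

/-- `ij` is an edge of the forest, with `j` a child of `i`. -/
def IsChild {V : Type*} (F : RootedForest V) (i j : V) : Prop :=
  F.parent j = some i

/-- `j` is a descendant of `i` (every vertex is a descendant of itself). -/
def IsDescendant {V : Type*} (F : RootedForest V) (i j : V) : Prop :=
  Relation.ReflTransGen F.IsChild i j

/-- `ij` is an improper edge, with `j` a child of `i`: some descendant of `j`
(possibly `j` itself) is lower-numbered than `i`. -/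
def IsImproper {V : Type*} [LT V] (F : RootedForest V) (i j : V) : Prop :=
  F.IsChild i j ∧ ∃ d, F.IsDescendant j d ∧ d < i

/-- `j` is a proper child of `i`: the edge `ij` is not improper. -/
def IsProperChild {V : Type*} [LT V] (F : RootedForest V) (i j : V) : Prop :=
  F.IsChild i j ∧ ¬ F.IsImproper i j

open Classical in
/-- The number of components of the forest: each tree has exactly one root. -/
noncomputable def numComponents {V : Type*} [Fintype V] (F : RootedForest V) : ℕ :=
  (Finset.univ.filter fun v => F.parent v = none).card

open Classical in
/-- The number of improper edges of the forest. -/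
noncomputable def numImproper {V : Type*} [Fintype V] [LT V] (F : RootedForest V) : ℕ :=
  (Finset.univ.filter fun e : V × V => F.IsImproper e.1 e.2).card

open Classical in
/-- The number of proper children of the vertex `i`. -/
noncomputable def numProperChildren {V : Type*} [Fintype V] [LT V] (F : RootedForest V)
    (i : V) : ℕ :=
  (Finset.univ.filter fun j => F.IsProperChild i j).card

/-- The weight of a forest: `y` for each improper edge,
and `m! φ_m` for each vertex with `m` proper children. -/
noncomputable def weight {V : Type*} [Fintype V] [LT V] {S : Type*} [CommRing S]
    (y : S) (φ : ℕ → S) (F : RootedForest V) : S :=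
  y ^ F.numImproper * ∏ i : V, (((F.numProperChildren i).factorial : S) * φ (F.numProperChildren i))

end RootedForest

open Classical in
/-- The generic rooted-forest polynomial `f_{n,k}(y, φ)`, evaluated at elements `y` and `φ_m` of a
commutative ring: the sum of the weights of the `k`-component forests of rooted trees on a totally
ordered set of `n` vertices. -/
noncomputable def rootedForestPoly {S : Type*} [CommRing S] (y : S) (φ : ℕ → S) (n k : ℕ) : S :=
  ∑ F : RootedForest (Fin n) with F.numComponents = k, F.weight y φ

/-- The row-generating polynomial `F_n(x, y, φ) = ∑_{ℓ=0}^n f_{n,ℓ}(y, φ) x^ℓ`. -/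
noncomputable def rowGenPoly {S : Type*} [CommRing S] (x y : S) (φ : ℕ → S) (n : ℕ) : S :=
  ∑ ℓ ∈ Finset.Icc 0 n, rootedForestPoly y φ n ℓ * x ^ ℓ

/-- The binomial partial row-generating polynomial
`F_{n,k}(x, y, φ) = ∑_{ℓ=k}^n f_{n,ℓ}(y, φ) (ℓ choose k) x^{ℓ-k}`. -/
noncomputable def binomRowGenPoly {S : Type*} [CommRing S] (x y : S) (φ : ℕ → S)
    (n k : ℕ) : S :=
  ∑ ℓ ∈ Finset.Icc k n, rootedForestPoly y φ n ℓ * (ℓ.choose k : S) * x ^ (ℓ - k)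

/-!
# Total positivity of the rooted-forest polynomials

Write `Φ(s) = ∑ φ_m s^m` and let `a` be the coefficient sequence of `Φ(s) / (1 - y s)`. The point of
the proof is that the polynomials `p_n = ∑_k f_{n,k} X^k` satisfy

  `p_0 = 1`,  `p_{n+1} = X · A(d/dX) p_n`,  where `A(d/dX) = ∑_m a_m (d/dX)^m`,

which is `isTriangle_rootedForestPoly`. It follows from two bijections. Deleting the smallest vertex,
when it is a root, leaves a forest together with a set of its roots, namely the former children of
that vertex, all of them proper (`RootedForest.sum_weight_of_parent_zero_eq_none`). When the smallest
vertex is not a root, the edge from the root of its tree towards it is improper, and cutting that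
edge changes the status of no other edge (`RootedForest.sum_weight_of_parent_ne_none`). Hence
`p_{n+1} = X g` with `g = Φ(d/dX) p_n + y g'`, so that `g = A(d/dX) p_n`.

The entries `F_{n,k}(x)` are the coefficients of `q_n = p_n(X + x)`. Since translation commutes with
`A(d/dX)`, one has `q_{n+1} = (X + x) · A(d/dX) q_n`, so each row of the matrix `F` is the previous
row times a fixed production matrix, the product of

* the matrix `(j! / k!) a_{j-k}` of `A(d/dX)` (`factorialToeplitz`), which is totally positive because
  the Toeplitz matrix of `a` is the product of that of `φ` and that of `1, y, y², …`;
* the bidiagonal matrix of multiplication by `X + x`.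

By the Cauchy–Binet formula the production matrix is totally positive, which implies that `F` is
totally positive (`IsTPOfOrder.of_production`) and that its zeroth column is Hankel-totally positive
(`isHankelTPOfOrder_of_production`). The numbers `f_{n+1,1}` are similarly `φ_0` times the zeroth
column of a triangle whose production matrix is `factorialToeplitz a` without its zeroth row.

All of this takes place in an arbitrary ring with a cone containing `x` and `y`; the theorem is the
case of polynomial rings with the coefficientwise order.
-/

/-! ### Minors of products and the Cauchy–Binet formula -/

namespace Matrix

/-- The Cauchy–Binet formula. -/
theorem det_mul_eq_sum_strictMono {S κ : Type*} [CommRing S] [Fintype κ] [LinearOrder κ] {s : ℕ}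
    (A : Matrix (Fin s) κ S) (B : Matrix κ (Fin s) S) :
    (A * B).det = ∑ g : Fin s → κ with StrictMono g,
      (A.submatrix id g).det * (B.submatrix g id).det := by
  have expand : (A * B).det = ∑ f : Fin s → κ, (∏ i, B (f i) i) * (A.submatrix id f).det := by
    simp only [det_apply', mul_apply, Finset.prod_univ_sum, Finset.mul_sum,
      Fintype.piFinset_univ, submatrix_apply, id]
    rw [Finset.sum_comm]
    refine Finset.sum_congr rfl fun f _ => Finset.sum_congr rfl fun σ _ => ?_
    rw [Finset.prod_mul_distrib]
    ring
  rw [expand, ← Finset.sum_filter_of_ne (p := Function.Injective)]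
  · have step : ∀ g : Fin s → κ, (A.submatrix id g).det * (B.submatrix g id).det =
        ∑ σ : Equiv.Perm (Fin s), (∏ i, B ((g ∘ σ) i) i) * (A.submatrix id (g ∘ σ)).det := by
      intro g
      rw [det_apply' (B.submatrix g id), Finset.mul_sum]
      refine Finset.sum_congr rfl fun σ _ => ?_
      have := det_permute' σ (A.submatrix id g)
      rw [submatrix_submatrix] at this
      rw [Function.id_comp] at this
      rw [this]
      simp only [submatrix_apply, id, Function.comp]
      ring
    rw [Finset.sum_congr rfl fun g _ => step g, ← Finset.sum_product']
    symm
    refine Finset.sum_bij (fun p _ => p.1 ∘ p.2) ?_ ?_ ?_ ?_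
    · rintro ⟨g, σ⟩ h
      simp only [Finset.mem_product, Finset.mem_filter, Finset.mem_univ, true_and, and_true] at h ⊢
      exact h.injective.comp σ.injective
    · rintro ⟨g, σ⟩ h ⟨g', σ'⟩ h' he
      simp only [Finset.mem_product, Finset.mem_filter, Finset.mem_univ, true_and, and_true]
        at h h' he
      have hg : g = g' := by
        refine (h.range_inj h').1 ?_
        rw [← σ.surjective.range_comp g, ← σ'.surjective.range_comp g', he]
      subst hg
      refine Prod.ext rfl (Equiv.ext fun i => h.injective (congrFun he i))
    · intro f hf
      simp only [Finset.mem_filter, Finset.mem_univ, true_and] at hf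
      refine ⟨(f ∘ Tuple.sort f, (Tuple.sort f)⁻¹), ?_, ?_⟩
      · simp only [Finset.mem_product, Finset.mem_filter, Finset.mem_univ, true_and, and_true]
        exact (Tuple.monotone_sort f).strictMono_of_injective
          (hf.comp (Tuple.sort f).injective)
      · funext i
        simp
    · intro p _
      rfl
  · intro f _ hf
    by_contra hinj
    obtain ⟨i, j, hij, hne⟩ : ∃ i j, f i = f j ∧ i ≠ j := by
      simpa [Function.Injective] using hinj
    exact hf (by rw [det_zero_of_column_eq hne fun k => by simp [hij], mul_zero])

theorem det_of_row_zero_eq_zero {S : Type*} [CommRing S] {n : ℕ}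
    (A : Matrix (Fin (n + 1)) (Fin (n + 1)) S) (h : ∀ j : Fin n, A 0 j.succ = 0) :
    A.det = A 0 0 * (A.submatrix Fin.succ Fin.succ).det := by
  rw [det_succ_row_zero, Fin.sum_univ_succ, Finset.sum_eq_zero fun j _ => by simp [h]]
  simp [Fin.succAbove_zero]

theorem det_of_column_zero_eq_zero {S : Type*} [CommRing S] {n : ℕ}
    (A : Matrix (Fin (n + 1)) (Fin (n + 1)) S) (h : ∀ i : Fin n, A i.succ 0 = 0) :
    A.det = A 0 0 * (A.submatrix Fin.succ Fin.succ).det := by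
  rw [← det_transpose, det_of_row_zero_eq_zero _ (by simpa using h), ← det_transpose]
  rfl

end Matrix

/-! ### Operations preserving total positivity -/

namespace IsTPOfOrder

variable {S : Type*} [CommRing S] {P : RingCone S} {r : ℕ∞}

theorem transpose {A : Matrix ℕ ℕ S} (hA : IsTPOfOrder P r A) : IsTPOfOrder P r A.transpose := by
  intro s hs rows cols hrows hcols
  rw [← Matrix.transpose_submatrix, Matrix.det_transpose]
  exact hA s hs cols rows hcols hrows

/-- Products of totally positive infinite matrices are totally positive. The product is only
required to make sense entry by entry, as an eventually constant sequence of partial sums. -/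
theorem of_eventually_eq_sum {A B C : Matrix ℕ ℕ S} (hA : IsTPOfOrder P r A)
    (hB : IsTPOfOrder P r B)
    (h : ∀ i k, ∃ N₀, ∀ N ≥ N₀, C i k = ∑ j ∈ Finset.range N, A i j * B j k) :
    IsTPOfOrder P r C := by
  intro s hs rows cols hrows hcols
  choose N₀ hN₀ using h
  set N : ℕ := Finset.univ.sup fun p : Fin s × Fin s => N₀ (rows p.1) (cols p.2) with hN
  have hprod : C.submatrix rows cols =
      A.submatrix rows (fun j : Fin N => (j : ℕ)) * B.submatrix (fun j : Fin N => (j : ℕ)) cols := by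
    ext i k
    rw [Matrix.mul_apply, Matrix.submatrix_apply, hN₀ _ _ N, Finset.sum_range]
    · rfl
    · exact Finset.le_sup (f := fun p : Fin s × Fin s => N₀ (rows p.1) (cols p.2))
        (Finset.mem_univ (i, k))
  rw [hprod, Matrix.det_mul_eq_sum_strictMono]
  refine sum_mem fun g hg => mul_mem ?_ ?_
  · have hg : StrictMono g := by simpa using hg
    exact hA s hs rows _ hrows (fun a b hab => hg hab)
  · have hg : StrictMono g := by simpa using hg
    exact hB s hs _ cols (fun a b hab => hg hab) hcols

/-- Total positivity is preserved by putting a row `(c, 0, 0, …)` with `c ≥ 0` on top. -/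
theorem of_submatrix_succ {B : Matrix ℕ ℕ S} (h0 : B 0 0 ∈ P) (h : ∀ k, B 0 (k + 1) = 0)
    (hB : IsTPOfOrder P r (B.submatrix Nat.succ id)) : IsTPOfOrder P r B := by
  have key : ∀ s : ℕ, (s : ℕ∞) ≤ r → ∀ rows cols : Fin s → ℕ, StrictMono rows → StrictMono cols →
      (∀ i, rows i ≠ 0) → (B.submatrix rows cols).det ∈ P := by
    intro s hs rows cols hrows hcols hne
    have hsucc : ∀ i, (rows i - 1) + 1 = rows i := fun i => by have := hne i; omega
    have := hB s hs (fun i => rows i - 1) cols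
      (fun i j hij => by
        have h1 := hrows hij
        have h2 := hsucc i
        have h3 := hsucc j
        show rows i - 1 < rows j - 1
        omega) hcols
    convert this using 2
    ext i j
    simp [hsucc]
  intro s hs rows cols hrows hcols
  cases s with
  | zero => exact key 0 hs rows cols hrows hcols fun i => i.elim0
  | succ s =>
    have hpos : ∀ i : Fin s, 0 < rows i.succ ∧ 0 < cols i.succ := fun i =>
      ⟨(Nat.zero_le _).trans_lt (hrows i.succ_pos), (Nat.zero_le _).trans_lt (hcols i.succ_pos)⟩
    have hrow : ∀ k, k ≠ 0 → B 0 k = 0 := fun k hk => by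
      obtain ⟨k, rfl⟩ := Nat.exists_eq_succ_of_ne_zero hk
      exact h k
    by_cases hr0 : rows 0 = 0
    · rw [Matrix.det_of_row_zero_eq_zero _ fun j => by
        simp [hr0, hrow _ (hpos j).2.ne']]
      by_cases hc0 : cols 0 = 0
      · refine mul_mem (by simpa [hr0, hc0] using h0) ?_
        exact key s (le_trans (by exact_mod_cast Nat.le_succ s) hs) _ _
          (hrows.comp (Fin.strictMono_succ)) (hcols.comp (Fin.strictMono_succ))
          (fun i => (hpos i).1.ne')
      · simp [hr0, hrow _ hc0, zero_mem P]
    · refine key _ hs rows cols hrows hcols fun i => ?_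
      have := hrows.monotone (Fin.zero_le i)
      omega

/-- An upper-bidiagonal matrix with nonnegative entries is totally positive. -/
theorem of_bidiagonal {A : Matrix ℕ ℕ S} (hA : ∀ i j, A i j ∈ P)
    (hlow : ∀ i j, j < i → A i j = 0) (hupp : ∀ i j, i + 1 < j → A i j = 0) :
    IsTPOfOrder P r A := by
  intro s hs
  clear hs
  induction s with
  | zero => intro rows cols _ _; simp [one_mem P]
  | succ s ih =>
    intro rows cols hrows hcols
    have hr : ∀ i : Fin s, rows 0 < rows i.succ := fun i => hrows i.succ_pos
    have hc : ∀ i : Fin s, cols 0 < cols i.succ := fun i => hcols i.succ_pos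
    have hrest := ih (rows ∘ Fin.succ) (cols ∘ Fin.succ) (hrows.comp Fin.strictMono_succ)
      (hcols.comp Fin.strictMono_succ)
    -- Either the first column or the first row of the minor vanishes off the corner.
    rcases le_or_gt (cols 0) (rows 0) with hle | hlt
    · rw [Matrix.det_of_column_zero_eq_zero _ fun i => hlow _ _ (hle.trans_lt (hr i))]
      exact mul_mem (hA _ _) hrest
    · rw [Matrix.det_of_row_zero_eq_zero _ fun i => hupp _ _ (Nat.lt_of_le_of_lt hlt (hc i))]
      exact mul_mem (hA _ _) hrest

theorem zero : IsTPOfOrder P r (0 : Matrix ℕ ℕ S) := by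
  intro s _ rows cols _ _
  cases s with
  | zero => simp [one_mem P]
  | succ s => simp [zero_mem P]

end IsTPOfOrder

/-! ### Production matrices -/

/-- The matrix `1 ⊕ A`. -/
def Matrix.oneDirectSum {S : Type*} [Zero S] [One S] (A : Matrix ℕ ℕ S) : Matrix ℕ ℕ S :=
  Matrix.of fun
    | 0, 0 => 1
    | 0, _ + 1 => 0
    | _ + 1, 0 => 0
    | i + 1, j + 1 => A i j

/-- The matrix `A` with the row `(1, 0, 0, …)` put on top. -/
def Matrix.consUnitRow {S : Type*} [Zero S] [One S] (A : Matrix ℕ ℕ S) : Matrix ℕ ℕ S :=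
  Matrix.of fun
    | 0, 0 => 1
    | 0, _ + 1 => 0
    | i + 1, j => A i j

namespace IsTPOfOrder

variable {S : Type*} [CommRing S] {P : RingCone S} {r : ℕ∞}

theorem consUnitRow {A : Matrix ℕ ℕ S} (hA : IsTPOfOrder P r A) :
    IsTPOfOrder P r A.consUnitRow :=
  of_submatrix_succ (one_mem P) (fun _ => rfl) hA

theorem oneDirectSum {A : Matrix ℕ ℕ S} (hA : IsTPOfOrder P r A) :
    IsTPOfOrder P r A.oneDirectSum := by
  refine of_submatrix_succ (one_mem P) (fun _ => rfl) ?_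
  rw [← Matrix.transpose_transpose (A.oneDirectSum.submatrix Nat.succ id)]
  refine transpose (of_submatrix_succ (zero_mem P) (fun _ => rfl) hA.transpose)

/-- If each row of `T` is the previous row times the totally positive matrix `Q`, starting from the
row `(1, 0, 0, …)`, then `T` is totally positive: the first `N + 1` rows of `T` are those of
`(1 ⊕ T_N) · Q'`, where `T_N` consists of the first `N` rows of `T` and `Q'` is `Q` with the row
`(1, 0, 0, …)` put on top. -/
theorem of_production {Q T : Matrix ℕ ℕ S} (hQ : IsTPOfOrder P r Q)
    (h0 : ∀ k, T 0 k = if k = 0 then 1 else 0)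
    (hs : ∀ n k, ∃ N₀, ∀ N ≥ N₀, T (n + 1) k = ∑ j ∈ Finset.range N, T n j * Q j k) :
    IsTPOfOrder P r T := by
  have trunc : ∀ N : ℕ, IsTPOfOrder P r (Matrix.of fun i j => if i < N then T i j else 0) := by
    intro N
    induction N with
    | zero => simpa using! zero (P := P) (r := r)
    | succ N ih =>
      refine of_eventually_eq_sum ih.oneDirectSum hQ.consUnitRow fun i k => ?_
      cases i with
      | zero =>
        refine ⟨1, fun m hm => ?_⟩
        obtain ⟨m, rfl⟩ := Nat.exists_eq_add_of_le' hm
        rw [Finset.sum_range_succ', Finset.sum_eq_zero]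
        · cases k <;> simp [h0, Matrix.oneDirectSum, Matrix.consUnitRow]
        · intro j _
          simp [Matrix.oneDirectSum]
      | succ n =>
        obtain ⟨N₀, hN₀⟩ := hs n k
        refine ⟨N₀ + 1, fun m hm => ?_⟩
        obtain ⟨m, rfl⟩ := Nat.exists_eq_add_of_le' (le_trans (Nat.le_add_left 1 N₀) hm)
        rw [Finset.sum_range_succ']
        simp only [Matrix.oneDirectSum, Matrix.consUnitRow, Matrix.of_apply, zero_mul, add_zero,
          ite_mul, add_lt_add_iff_right]
        split_ifs
        · exact hN₀ m (by omega)
        · simp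
  intro s hs rows cols hrows hcols
  have := trunc (Finset.univ.sup rows + 1) s hs rows cols hrows hcols
  convert this using 2
  ext i j
  have : rows i ≤ Finset.univ.sup rows := Finset.le_sup (Finset.mem_univ i)
  simp [this.not_gt]

end IsTPOfOrder

/-- The `n`-th row of `Matrix.columnIterates Q` is the zeroth column of `Q ^ n`, for a matrix `Q`
whose entries vanish above the first superdiagonal. -/
def Matrix.columnIterates {S : Type*} [CommRing S] (Q : Matrix ℕ ℕ S) : ℕ → ℕ → S
  | 0, k => if k = 0 then 1 else 0
  | n + 1, k => ∑ l ∈ Finset.range (k + 2), Matrix.columnIterates Q n l * Q k l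

section Production

variable {S : Type*} [CommRing S] {P : RingCone S} {r : ℕ∞} {Q T : Matrix ℕ ℕ S}

theorem eq_zero_of_production (hQ : ∀ j k, j + 1 < k → Q j k = 0)
    (h0 : ∀ k, T 0 k = if k = 0 then 1 else 0)
    (hs : ∀ n k, T (n + 1) k = ∑ j ∈ Finset.range (n + 1), T n j * Q j k) :
    ∀ n k, n < k → T n k = 0 := by
  intro n k hk
  cases n with
  | zero => simp [h0, hk.ne']
  | succ n =>
    rw [hs]
    refine Finset.sum_eq_zero fun j hj => ?_
    rw [hQ j k (by have := Finset.mem_range.1 hj; omega), mul_zero]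

theorem isTPOfOrder_of_production (hQTP : IsTPOfOrder P r Q) (hQ : ∀ j k, j + 1 < k → Q j k = 0)
    (h0 : ∀ k, T 0 k = if k = 0 then 1 else 0)
    (hs : ∀ n k, T (n + 1) k = ∑ j ∈ Finset.range (n + 1), T n j * Q j k) :
    IsTPOfOrder P r T := by
  refine IsTPOfOrder.of_production hQTP h0 fun n k => ⟨n + 1, fun N hN => ?_⟩
  rw [hs]
  refine Finset.sum_subset (Finset.range_subset_range.2 hN) fun j _ hj => ?_
  rw [eq_zero_of_production hQ h0 hs n j (by simpa using hj), zero_mul]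

theorem production_add_eq_sum (hQ : ∀ j k, j + 1 < k → Q j k = 0)
    (hs : ∀ n k, T (n + 1) k = ∑ j ∈ Finset.range (n + 1), T n j * Q j k) (i j : ℕ) :
    T (i + j) 0 = ∑ k ∈ Finset.range (i + 1), T i k * Q.columnIterates j k := by
  induction j generalizing i with
  | zero => simp [Matrix.columnIterates]
  | succ j ih =>
    rw [show i + (j + 1) = i + 1 + j by ring, ih]
    simp only [hs, Matrix.columnIterates, Finset.sum_mul, Finset.mul_sum]
    rw [Finset.sum_comm]
    refine Finset.sum_congr rfl fun l hl => ?_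
    symm
    refine (Finset.sum_congr rfl fun k _ => by ring).trans (Finset.sum_subset
      (Finset.range_subset_range.2 (by have := Finset.mem_range.1 hl; omega)) fun k _ hk => ?_)
    rw [hQ l k (by simp at hk; omega)]
    ring

/-- The zeroth column of a matrix with totally positive production matrix `Q` is a Hankel-totally
positive sequence: its Hankel matrix is the product of the matrix of zeroth rows of powers of `Q`
with the transposed matrix of zeroth columns of powers of `Q`. -/
theorem isHankelTPOfOrder_of_production (hQTP : IsTPOfOrder P r Q)
    (hQ : ∀ j k, j + 1 < k → Q j k = 0) (h0 : ∀ k, T 0 k = if k = 0 then 1 else 0)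
    (hs : ∀ n k, T (n + 1) k = ∑ j ∈ Finset.range (n + 1), T n j * Q j k) :
    IsHankelTPOfOrder P r fun n => T n 0 := by
  have hcol : IsTPOfOrder P r (Matrix.of Q.columnIterates) := by
    refine IsTPOfOrder.of_production hQTP.transpose (fun k => rfl) fun n k =>
      ⟨k + 2, fun N hN => ?_⟩
    refine Finset.sum_subset (Finset.range_subset_range.2 hN) fun l _ hl => ?_
    change Q.columnIterates n l * Q k l = 0
    rw [hQ k l (by simp at hl; omega), mul_zero]
  refine IsTPOfOrder.of_eventually_eq_sum (isTPOfOrder_of_production hQTP hQ h0 hs) hcol.transpose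
    fun i j => ⟨i + 1, fun N hN => ?_⟩
  rw [hankelMatrix, Matrix.of_apply, production_add_eq_sum hQ hs]
  refine Finset.sum_subset (Finset.range_subset_range.2 hN) fun k _ hk => ?_
  rw [eq_zero_of_production hQ h0 hs i k (by simpa using hk), zero_mul]

end Production

theorem IsHankelTPOfOrder.const_mul {S : Type*} [CommRing S] {P : RingCone S} {r : ℕ∞}
    {a : ℕ → S} {c : S} (hc : c ∈ P) (ha : IsHankelTPOfOrder P r a) :
    IsHankelTPOfOrder P r fun n => c * a n := by
  intro s hs rows cols hrows hcols
  have : (hankelMatrix fun n => c * a n).submatrix rows cols =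
      c • (hankelMatrix a).submatrix rows cols := by
    ext i j
    simp [hankelMatrix]
  rw [this, Matrix.det_smul]
  exact mul_mem (pow_mem hc _) (ha s hs rows cols hrows hcols)

/-! ### Toeplitz matrices weighted by factorials -/

/-- The lower-triangular matrix with entries `(j! / k!) a_{j-k}`: the Toeplitz matrix of `a`
conjugated by `diag(0!, 1!, 2!, …)`. -/
def factorialToeplitz {S : Type*} [CommRing S] (a : ℕ → S) : Matrix ℕ ℕ S :=
  Matrix.of fun j k => if k ≤ j then (j.descFactorial (j - k) : S) * a (j - k) else 0

/-- The convolution of the sequence `φ` with the geometric sequence `1, y, y², …`. -/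
def geomConvolution {S : Type*} [CommRing S] (y : S) (φ : ℕ → S) : ℕ → S
  | 0 => φ 0
  | n + 1 => φ (n + 1) + y * geomConvolution y φ n

section Toeplitz

variable {S : Type*} [CommRing S] {P : RingCone S} {r : ℕ∞}

theorem factorialToeplitz_eq_zero (a : ℕ → S) {j k : ℕ} (h : j < k) :
    factorialToeplitz a j k = 0 := by
  simp [factorialToeplitz, h]

/-- Each minor of `factorialToeplitz a` is a natural multiple of the same minor of the Toeplitz
matrix: a term of the determinant that does not vanish only involves entries on or below the
diagonal, so that the product of its factors `j! / k!` is the integer `∏ j! / ∏ k!`, which does not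
depend on the term. No division takes place in the ring. -/
theorem IsToeplitzTPOfOrder.factorialToeplitz {a : ℕ → S} (ha : IsToeplitzTPOfOrder P r a) :
    IsTPOfOrder P r (factorialToeplitz a) := by
  intro s hs rows cols hrows hcols
  have hdet : ((_root_.factorialToeplitz a).submatrix rows cols).det =
      (((∏ i, (rows i).factorial) / ∏ i, (cols i).factorial : ℕ) : S) *
        ((toeplitzMatrix a).submatrix rows cols).det := by
    rw [Matrix.det_apply', Matrix.det_apply', Finset.mul_sum]
    refine Finset.sum_congr rfl fun σ _ => ?_
    by_cases hσ : ∀ i, cols i ≤ rows (σ i)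
    · have hc : (∏ i, (rows i).factorial) / ∏ i, (cols i).factorial =
          ∏ i, (rows (σ i)).descFactorial (rows (σ i) - cols i) := by
        refine Nat.div_eq_of_eq_mul_left (Finset.prod_pos fun i _ => Nat.factorial_pos _) ?_
        rw [← Equiv.prod_comp σ, ← Finset.prod_mul_distrib]
        refine Finset.prod_congr rfl fun i _ => ?_
        rw [← Nat.factorial_mul_descFactorial (Nat.sub_le (rows (σ i)) (cols i)),
          Nat.sub_sub_self (hσ i), mul_comm]
      rw [hc]
      simp only [Matrix.submatrix_apply, _root_.factorialToeplitz, toeplitzMatrix, Matrix.of_apply,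
        hσ, if_true, Finset.prod_mul_distrib, Nat.cast_prod]
      ring
    · obtain ⟨i, hi⟩ := not_forall.1 hσ
      have h1 : ∏ i, (_root_.factorialToeplitz a).submatrix rows cols (σ i) i = 0 :=
        Finset.prod_eq_zero (Finset.mem_univ i) (by simp [_root_.factorialToeplitz, hi])
      have h2 : ∏ i, (toeplitzMatrix a).submatrix rows cols (σ i) i = 0 :=
        Finset.prod_eq_zero (Finset.mem_univ i) (by simp [toeplitzMatrix, hi])
      rw [h1, h2, mul_zero, mul_zero]
  rw [hdet]
  exact mul_mem (natCast_mem P _) (ha s hs rows cols hrows hcols)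

theorem isToeplitzTPOfOrder_geom {y : S} (hy : y ∈ P) :
    IsToeplitzTPOfOrder P r fun n => y ^ n := by
  let Q : Matrix ℕ ℕ S := Matrix.of fun j k =>
    if j = 0 ∧ k = 0 then y else if k = j + 1 then 1 else 0
  have hQ : IsTPOfOrder P r Q := by
    refine IsTPOfOrder.of_bidiagonal (fun i j => ?_) (fun i j h => ?_) fun i j h => ?_
    · simp only [Q, Matrix.of_apply]
      split_ifs
      · exact hy
      · exact one_mem P
      · exact zero_mem P
    · simp [Q, show ¬(i = 0 ∧ j = 0) by omega, show j ≠ i + 1 by omega]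
    · simp [Q, show ¬(i = 0 ∧ j = 0) by omega, show j ≠ i + 1 by omega]
  refine isTPOfOrder_of_production hQ (fun j k h => ?_) (fun k => ?_) fun n k => ?_
  · simp [Q, show ¬(j = 0 ∧ k = 0) by omega, show k ≠ j + 1 by omega]
  · simp [toeplitzMatrix]
  · cases k with
    | zero =>
      rw [Finset.sum_range_succ', Finset.sum_eq_zero fun j _ => by simp [Q]]
      simp [toeplitzMatrix, Q, pow_succ]
    | succ k =>
      simp [toeplitzMatrix, Q]
      intro h
      omega

theorem toeplitzMatrix_geomConvolution (y : S) (φ : ℕ → S) (i k : ℕ) :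
    toeplitzMatrix (geomConvolution y φ) i k =
      ∑ j ∈ Finset.range (i + 1), y ^ (i - j) * toeplitzMatrix φ j k := by
  induction i with
  | zero => cases k <;> simp [toeplitzMatrix, geomConvolution]
  | succ i ih =>
    have hrec : toeplitzMatrix (geomConvolution y φ) (i + 1) k =
        y * toeplitzMatrix (geomConvolution y φ) i k + toeplitzMatrix φ (i + 1) k := by
      simp only [toeplitzMatrix, Matrix.of_apply]
      rcases lt_trichotomy k (i + 1) with h | rfl | h
      · rw [if_pos h.le, if_pos (Nat.le_of_lt_succ h), if_pos h.le,
          show i + 1 - k = i - k + 1 by omega]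
        simp only [geomConvolution]
        ring
      · simp [geomConvolution]
      · simp [show ¬ k ≤ i + 1 by omega, show ¬ k ≤ i by omega]
    rw [hrec, ih, Finset.sum_range_succ _ (i + 1), Finset.mul_sum]
    congr 1
    · refine Finset.sum_congr rfl fun j hj => ?_
      rw [show i + 1 - j = i - j + 1 by have := Finset.mem_range.1 hj; omega]
      ring
    · simp

theorem IsToeplitzTPOfOrder.geomConvolution {y : S} (hy : y ∈ P) {φ : ℕ → S}
    (hφ : IsToeplitzTPOfOrder P r φ) : IsToeplitzTPOfOrder P r (geomConvolution y φ) := by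
  refine IsTPOfOrder.of_eventually_eq_sum (isToeplitzTPOfOrder_geom hy) hφ
    fun i k => ⟨i + 1, fun N hN => ?_⟩
  rw [toeplitzMatrix_geomConvolution]
  refine (Finset.sum_congr rfl fun j hj => ?_).trans
    (Finset.sum_subset (Finset.range_subset_range.2 hN) fun j _ hj => ?_)
  · have : j ≤ i := Nat.le_of_lt_succ (Finset.mem_range.1 hj)
    simp [toeplitzMatrix, this]
  · have : ¬ j ≤ i := by simpa [Nat.lt_succ_iff] using hj
    simp [toeplitzMatrix, this]

theorem IsToeplitzTPOfOrder.zero_mem {φ : ℕ → S} (hr : 1 ≤ r) (hφ : IsToeplitzTPOfOrder P r φ) :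
    φ 0 ∈ P := by
  simpa [toeplitzMatrix] using hφ 1 (by simpa using hr) (fun _ => 0) (fun _ => 0)
    (Subsingleton.strictMono _) (Subsingleton.strictMono _)

/-- `factorialToeplitz` turns the recursion `a_{m+1} = φ_{m+1} + y a_m` of the geometric
convolution into a recursion in the column index. -/
theorem factorialToeplitz_geomConvolution (y : S) (φ : ℕ → S) (j k : ℕ) :
    factorialToeplitz (geomConvolution y φ) j k = factorialToeplitz φ j k +
      y * (k + 1) * factorialToeplitz (geomConvolution y φ) j (k + 1) := by
  simp only [factorialToeplitz, Matrix.of_apply]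
  rcases lt_trichotomy k j with h | rfl | h
  · rw [if_pos h.le, if_pos h.le, if_pos (Nat.succ_le_of_lt h)]
    obtain ⟨d, rfl⟩ := Nat.exists_eq_add_of_lt h
    rw [show k + d + 1 - k = d + 1 by omega, show k + d + 1 - (k + 1) = d by omega,
      Nat.descFactorial_succ, show k + d + 1 - d = k + 1 by omega]
    simp only [geomConvolution]
    push_cast
    ring
  · simp [geomConvolution]
  · simp [show ¬ k ≤ j by omega, show ¬ k + 1 ≤ j by omega]

end Toeplitz

/-! ### Constant-coefficient differential operators -/

section Operator

open Polynomial

variable {S : Type*} [CommRing S]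

/-- The differential operator `∑_{m < N} a_m (d/dX)^m` on `S[X]`. -/
noncomputable def diffOp (a : ℕ → S) (N : ℕ) (p : S[X]) : S[X] :=
  ∑ m ∈ Finset.range N, a m • derivative^[m] p

theorem coeff_diffOp (a : ℕ → S) {N : ℕ} {p : S[X]} (hp : ∀ j, N ≤ j → p.coeff j = 0) (k : ℕ) :
    (diffOp a N p).coeff k = ∑ j ∈ Finset.range N, p.coeff j * factorialToeplitz a j k := by
  simp only [diffOp, finsetSum_coeff, coeff_smul, coeff_iterate_derivative, factorialToeplitz,
    Matrix.of_apply, smul_eq_mul, nsmul_eq_mul]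
  have hext : ∑ j ∈ Finset.range N,
      p.coeff j * (if k ≤ j then (j.descFactorial (j - k) : S) * a (j - k) else 0) =
      ∑ j ∈ Finset.range (k + N),
        p.coeff j * (if k ≤ j then (j.descFactorial (j - k) : S) * a (j - k) else 0) :=
    Finset.sum_subset (Finset.range_subset_range.2 (Nat.le_add_left _ _)) fun j _ hj => by
      rw [hp j (by simpa using hj), zero_mul]
  rw [hext, Finset.sum_range_add, Finset.sum_eq_zero (s := Finset.range k) fun j hj => by
    rw [if_neg (by simpa using hj), mul_zero], zero_add]
  refine Finset.sum_congr rfl fun m _ => ?_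
  rw [if_pos (Nat.le_add_right _ _), Nat.add_sub_cancel_left]
  ring

theorem taylor_derivative (x : S) (p : S[X]) :
    taylor x (derivative p) = derivative (taylor x p) := by
  simp [taylor_apply, derivative_comp]

theorem taylor_diffOp (x : S) (a : ℕ → S) (N : ℕ) (p : S[X]) :
    taylor x (diffOp a N p) = diffOp a N (taylor x p) := by
  have hiter : ∀ m : ℕ, taylor x (derivative^[m] p) = derivative^[m] (taylor x p) := fun m => by
    induction m with
    | zero => rfl
    | succ m ih => rw [Function.iterate_succ_apply', Function.iterate_succ_apply',
        taylor_derivative, ih]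
  simp [diffOp, map_sum, hiter]

end Operator

/-! ### Triangles generated by a factorially weighted Toeplitz matrix -/

section Triangle

open Polynomial

variable {S : Type*} [CommRing S] {P : RingCone S} {r : ℕ∞}

/-- The triangle `f` of coefficients of the polynomials `p_n` given by `p_0 = 1` and
`p_{n+1} = X · (∑_m a_m (d/dX)^m) p_n`. In terms of matrices, the production matrix of `f` is
`factorialToeplitz a` shifted one column to the right. -/
structure IsTriangle (a : ℕ → S) (f : ℕ → ℕ → S) : Prop where
  row_zero : ∀ k, f 0 k = if k = 0 then 1 else 0
  succ_zero : ∀ n, f (n + 1) 0 = 0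
  succ_succ : ∀ n k, f (n + 1) (k + 1) =
    ∑ j ∈ Finset.range (n + 1), f n j * factorialToeplitz a j k

/-- The row-generating polynomial `∑_k f_{n,k} X^k`. -/
noncomputable def rowPolynomial (f : ℕ → ℕ → S) (n : ℕ) : S[X] :=
  ∑ k ∈ Finset.range (n + 1), monomial k (f n k)

/-- A production matrix for `taylor x` of the row-generating polynomials: the product of
`factorialToeplitz a` and the bidiagonal matrix with `x` on the diagonal and `1` above it. -/
def taylorProduction (x : S) (a : ℕ → S) : Matrix ℕ ℕ S :=
  Matrix.of fun
    | j, 0 => x * factorialToeplitz a j 0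
    | j, k + 1 => x * factorialToeplitz a j (k + 1) + factorialToeplitz a j k

theorem taylorProduction_eq_zero (x : S) (a : ℕ → S) (j k : ℕ) (h : j + 1 < k) :
    taylorProduction x a j k = 0 := by
  cases k with
  | zero => omega
  | succ k =>
    simp [taylorProduction, factorialToeplitz_eq_zero a (show j < k + 1 by omega),
      factorialToeplitz_eq_zero a (show j < k by omega)]

theorem isTPOfOrder_taylorProduction {x : S} (hx : x ∈ P) {a : ℕ → S}
    (ha : IsToeplitzTPOfOrder P r a) : IsTPOfOrder P r (taylorProduction x a) := by
  let B : Matrix ℕ ℕ S := Matrix.of fun j k => if k = j then x else if k = j + 1 then 1 else 0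
  have hB : IsTPOfOrder P r B := by
    refine IsTPOfOrder.of_bidiagonal (fun i j => ?_) (fun i j h => ?_) fun i j h => ?_
    · simp only [B, Matrix.of_apply]
      split_ifs
      · exact hx
      · exact one_mem P
      · exact zero_mem P
    · simp [B, h.ne, show j ≠ i + 1 by omega]
    · simp [B, show j ≠ i by omega, h.ne']
  refine IsTPOfOrder.of_eventually_eq_sum ha.factorialToeplitz hB
    fun i k => ⟨k + 1, fun N hN => ?_⟩
  rw [← Finset.sum_subset (Finset.range_subset_range.2 hN) fun j _ hj => by
    simp only [Finset.mem_range, not_lt] at hj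
    simp [B, show k ≠ j by omega, show k ≠ j + 1 by omega]]
  cases k with
  | zero => simp [B, taylorProduction, mul_comm]
  | succ k =>
    rw [Finset.sum_range_succ, Finset.sum_range_succ, Finset.sum_eq_zero fun j hj => by
      have := Finset.mem_range.1 hj
      simp [B, show k + 1 ≠ j by omega, show k ≠ j by omega]]
    simp [B, taylorProduction]
    ring

theorem coeff_taylor_rowPolynomial (f : ℕ → ℕ → S) (x : S) (n k : ℕ) :
    (taylor x (rowPolynomial f n)).coeff k =
      ∑ ℓ ∈ Finset.Icc k n, f n ℓ * (ℓ.choose k : S) * x ^ (ℓ - k) := by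
  rw [taylor_coeff, rowPolynomial, map_sum, eval_finsetSum]
  symm
  refine (Finset.sum_congr rfl fun ℓ _ => ?_).trans
    (Finset.sum_subset (fun ℓ h => ?_) fun ℓ hℓ h => ?_)
  · rw [hasseDeriv_monomial, eval_monomial, mul_comm (ℓ.choose k : S)]
  · simp only [Finset.mem_Icc, Finset.mem_range] at h ⊢
    omega
  · have : ℓ < k := by
      simp only [Finset.mem_Icc, Finset.mem_range] at h hℓ
      omega
    simp [hasseDeriv_monomial, Nat.choose_eq_zero_of_lt this]

namespace IsTriangle

variable {a : ℕ → S} {f : ℕ → ℕ → S}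

theorem eq_zero (hf : IsTriangle a f) {n k : ℕ} (h : n < k) : f n k = 0 := by
  cases n with
  | zero => simp [hf.row_zero, h.ne']
  | succ n =>
    obtain ⟨k, rfl⟩ := Nat.exists_eq_succ_of_ne_zero (show k ≠ 0 by omega)
    rw [Nat.succ_eq_add_one, hf.succ_succ]
    refine Finset.sum_eq_zero fun j hj => ?_
    rw [factorialToeplitz_eq_zero a (by have := Finset.mem_range.1 hj; omega), mul_zero]

theorem coeff_rowPolynomial (hf : IsTriangle a f) (n k : ℕ) :
    (rowPolynomial f n).coeff k = f n k := by
  simp only [rowPolynomial, finsetSum_coeff, coeff_monomial, Finset.sum_ite_eq',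
    Finset.mem_range]
  split_ifs with h
  · rfl
  · exact (hf.eq_zero (by omega)).symm

theorem rowPolynomial_succ (hf : IsTriangle a f) (n : ℕ) :
    rowPolynomial f (n + 1) = X * diffOp a (n + 1) (rowPolynomial f n) := by
  ext k
  rw [hf.coeff_rowPolynomial]
  cases k with
  | zero => simp [hf.succ_zero]
  | succ k =>
    rw [coeff_X_mul, coeff_diffOp _ fun j hj => by
      rw [hf.coeff_rowPolynomial, hf.eq_zero (by omega)], hf.succ_succ]
    simp only [hf.coeff_rowPolynomial]

/-- `taylor x` commutes with differential operators with constant coefficients, and turns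
multiplication by `X` into multiplication by `X + x`. -/
theorem coeff_taylor_rowPolynomial_succ (hf : IsTriangle a f) (x : S) (n k : ℕ) :
    (taylor x (rowPolynomial f (n + 1))).coeff k = ∑ j ∈ Finset.range (n + 1),
      (taylor x (rowPolynomial f n)).coeff j * taylorProduction x a j k := by
  have hcoeff : ∀ k, (diffOp a (n + 1) (taylor x (rowPolynomial f n))).coeff k =
      ∑ j ∈ Finset.range (n + 1),
        (taylor x (rowPolynomial f n)).coeff j * factorialToeplitz a j k := fun k =>
    coeff_diffOp a (fun j hj => by
      rw [coeff_taylor_rowPolynomial, Finset.Icc_eq_empty (by omega), Finset.sum_empty]) k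
  rw [hf.rowPolynomial_succ, taylor_mul, taylor_X, taylor_diffOp, add_mul, coeff_add, coeff_C_mul]
  cases k with
  | zero =>
    rw [hcoeff, coeff_X_mul_zero, zero_add, Finset.mul_sum]
    refine Finset.sum_congr rfl fun j _ => ?_
    simp only [taylorProduction, Matrix.of_apply]
    ring
  | succ k =>
    rw [hcoeff, coeff_X_mul, hcoeff, Finset.mul_sum, ← Finset.sum_add_distrib]
    refine Finset.sum_congr rfl fun j _ => ?_
    simp only [taylorProduction, Matrix.of_apply]
    ring

theorem coeff_taylor_rowPolynomial_zero (hf : IsTriangle a f) (x : S) (k : ℕ) :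
    (taylor x (rowPolynomial f 0)).coeff k = if k = 0 then 1 else 0 := by
  rw [coeff_taylor_rowPolynomial]
  cases k <;> simp [hf.row_zero]

theorem isTPOfOrder_taylor (hf : IsTriangle a f) (ha : IsToeplitzTPOfOrder P r a) {x : S}
    (hx : x ∈ P) :
    IsTPOfOrder P r (Matrix.of fun n k => (taylor x (rowPolynomial f n)).coeff k) :=
  isTPOfOrder_of_production (isTPOfOrder_taylorProduction hx ha) (taylorProduction_eq_zero x a)
    (hf.coeff_taylor_rowPolynomial_zero x) (hf.coeff_taylor_rowPolynomial_succ x)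

theorem isHankelTPOfOrder_taylor (hf : IsTriangle a f) (ha : IsToeplitzTPOfOrder P r a) {x : S}
    (hx : x ∈ P) :
    IsHankelTPOfOrder P r fun n => (taylor x (rowPolynomial f n)).coeff 0 :=
  isHankelTPOfOrder_of_production
    (T := Matrix.of fun n k => (taylor x (rowPolynomial f n)).coeff k)
    (isTPOfOrder_taylorProduction hx ha) (taylorProduction_eq_zero x a)
    (hf.coeff_taylor_rowPolynomial_zero x) (hf.coeff_taylor_rowPolynomial_succ x)

/-- The triangle without its zeroth row and zeroth column is `a_0` times the triangle whose
production matrix is `factorialToeplitz a` without its zeroth row. -/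
theorem isHankelTPOfOrder_column_one (hf : IsTriangle a f) (ha : IsToeplitzTPOfOrder P r a)
    (ha0 : a 0 ∈ P) : IsHankelTPOfOrder P r fun n => f (n + 1) 1 := by
  let Q : Matrix ℕ ℕ S := (factorialToeplitz a).submatrix Nat.succ id
  let T : ℕ → ℕ → S := fun n => Nat.rec (fun k => if k = 0 then 1 else 0)
    (fun n t k => ∑ j ∈ Finset.range (n + 1), t j * Q j k) n
  have hQTP : IsTPOfOrder P r Q := fun s hs rows cols hrows hcols =>
    ha.factorialToeplitz s hs (Nat.succ ∘ rows) cols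
      (fun _ _ h => Nat.succ_lt_succ (hrows h)) hcols
  have hQ : ∀ j k, j + 1 < k → Q j k = 0 := fun j k h => factorialToeplitz_eq_zero a h
  have hT : ∀ n k, f (n + 1) (k + 1) = a 0 * T n k := by
    intro n
    induction n with
    | zero =>
      intro k
      rw [hf.succ_succ]
      cases k <;> simp [hf.row_zero, factorialToeplitz, T]
    | succ n ih =>
      intro k
      rw [hf.succ_succ, Finset.sum_range_succ', hf.succ_zero, zero_mul, add_zero]
      simp only [ih, mul_assoc, ← Finset.mul_sum]
      rfl
  have := (isHankelTPOfOrder_of_production (T := T) hQTP hQ (fun k => rfl)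
    (fun n k => rfl)).const_mul ha0
  simpa only [hT] using this

end IsTriangle

end Triangle

/-! ### Cutting a subtree off a rooted forest -/

namespace RootedForest

section Roots

variable {V : Type*} (F : RootedForest V)

theorem IsDescendant.eq_of_parent_eq_none {F : RootedForest V} {i j : V}
    (h : F.IsDescendant i j) (hj : F.parent j = none) : i = j := by
  rcases Relation.ReflTransGen.cases_tail h with h | ⟨c, -, hc⟩
  · exact h.symm
  · simp [IsChild, hj] at hc

theorem wellFounded_isChild [Finite V] : WellFounded F.IsChild := by
  have : IsTrans V (Relation.TransGen F.IsChild) := ⟨fun _ _ _ => Relation.TransGen.trans⟩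
  have : Std.Irrefl (Relation.TransGen F.IsChild) := ⟨F.acyclic⟩
  have hwf : WellFounded (Relation.TransGen F.IsChild) := Finite.wellFounded_of_trans_of_irrefl _
  exact Subrelation.wf (fun h => Relation.TransGen.single h) hwf

/-- A vertex that is not a root descends from a child `r` of a root `v`. -/
theorem exists_child_of_root [Finite V] (u : V) (hu : F.parent u ≠ none) :
    ∃ v r, F.parent v = none ∧ F.parent r = some v ∧ F.IsDescendant r u := by
  induction u using F.wellFounded_isChild.induction with
  | _ u ih =>
    obtain ⟨p, hp⟩ := Option.ne_none_iff_exists'.1 hu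
    by_cases hpn : F.parent p = none
    · exact ⟨p, u, hpn, hp, Relation.ReflTransGen.refl⟩
    · obtain ⟨v, r, hv, hr, hd⟩ := ih p hp hpn
      exact ⟨v, r, hv, hr, Relation.ReflTransGen.tail hd hp⟩

theorem exists_root [Finite V] (u : V) : ∃ r, F.parent r = none ∧ F.IsDescendant r u := by
  by_cases hu : F.parent u = none
  · exact ⟨u, hu, Relation.ReflTransGen.refl⟩
  · obtain ⟨v, r, hv, hr, hd⟩ := F.exists_child_of_root u hu
    exact ⟨v, hv, Relation.ReflTransGen.head hr hd⟩

theorem root_unique {F : RootedForest V} {r r' u : V} (hr : F.parent r = none)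
    (hr' : F.parent r' = none) (hd : F.IsDescendant r u) (hd' : F.IsDescendant r' u) : r = r' := by
  have hU : Relator.RightUnique (Function.swap F.IsChild) := fun a b c hb hc => by
    have hb' : F.parent a = some b := hb
    have hc' : F.parent a = some c := hc
    exact Option.some_injective _ (hb'.symm.trans hc')
  rcases Relation.ReflTransGen.total_of_right_unique hU (Relation.reflTransGen_swap.2 hd)
    (Relation.reflTransGen_swap.2 hd') with h | h
  · exact (IsDescendant.eq_of_parent_eq_none (Relation.reflTransGen_swap.1 h) hr).symm
  · exact IsDescendant.eq_of_parent_eq_none (Relation.reflTransGen_swap.1 h) hr'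

end Roots

section Cut

variable {V : Type*} [DecidableEq V]

/-- The forest obtained by removing the edge from `r` to its parent, making `r` a root. -/
def cut (F : RootedForest V) (r : V) : RootedForest V where
  parent := Function.update F.parent r none
  acyclic v h := by
    refine F.acyclic v (Relation.TransGen.mono (fun i j hij => ?_) _ _ h)
    by_cases hj : j = r
    · subst hj
      simp at hij
    · simpa [Function.update_of_ne hj] using hij

/-- The forest obtained by making the root `r` a child of a vertex `v` of another tree. -/
def attach (F : RootedForest V) (r v : V) (hr : F.parent r = none)
    (hv : ¬ F.IsDescendant r v) : RootedForest V where
  parent := Function.update F.parent r (some v)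
  acyclic w h := by
    -- A path in the new forest either avoids the new edge or uses it exactly once.
    have key : ∀ a b,
        Relation.TransGen (fun i j => Function.update F.parent r (some v) j = some i) a b →
        Relation.TransGen F.IsChild a b ∨ (F.IsDescendant a v ∧ F.IsDescendant r b) := by
      have edge : ∀ i j, Function.update F.parent r (some v) j = some i →
          F.IsChild i j ∨ (i = v ∧ j = r) := by
        intro i j hij
        by_cases hj : j = r
        · subst hj
          simp only [Function.update_self, Option.some.injEq] at hij
          exact Or.inr ⟨hij.symm, rfl⟩
        · rw [Function.update_of_ne hj] at hij
          exact Or.inl hij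
      intro a b hab
      induction hab with
      | single hab =>
        rcases edge _ _ hab with h | ⟨rfl, rfl⟩
        · exact Or.inl (Relation.TransGen.single h)
        · exact Or.inr ⟨Relation.ReflTransGen.refl, Relation.ReflTransGen.refl⟩
      | tail _ hbc ih =>
        rcases edge _ _ hbc with h | ⟨rfl, rfl⟩
        · rcases ih with ih | ⟨ih, ih'⟩
          · exact Or.inl (ih.tail h)
          · exact Or.inr ⟨ih, Relation.ReflTransGen.tail ih' h⟩
        · rcases ih with ih | ⟨ih, ih'⟩
          · exact Or.inr ⟨ih.to_reflTransGen, Relation.ReflTransGen.refl⟩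
          · exact absurd ih' hv
    rcases key w w h with h | ⟨h, h'⟩
    · exact F.acyclic w h
    · exact hv (Relation.ReflTransGen.trans h' h)

theorem cut_attach (F : RootedForest V) (r v : V) (hr : F.parent r = none)
    (hv : ¬ F.IsDescendant r v) : (F.attach r v hr hv).cut r = F := by
  ext1
  simp [cut, attach, ← hr]

variable {F : RootedForest V} {r v : V}

theorem cut_parent_eq_none_iff {i : V} :
    (F.cut r).parent i = none ↔ F.parent i = none ∨ i = r := by
  by_cases hi : i = r
  · simp [cut, hi]
  · simp [cut, hi]

theorem isChild_cut_iff {i j : V} : (F.cut r).IsChild i j ↔ F.IsChild i j ∧ j ≠ r := by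
  by_cases hj : j = r
  · simp [IsChild, cut, hj]
  · simp [IsChild, cut, hj]

theorem IsDescendant.of_cut {i j : V} (h : (F.cut r).IsDescendant i j) : F.IsDescendant i j :=
  Relation.ReflTransGen.mono (fun _ _ h => (isChild_cut_iff.1 h).1) _ _ h

theorem isDescendant_cut_iff (hr : F.parent r = some v) (hv : F.parent v = none) {j d : V}
    (hj : j ≠ v) : (F.cut r).IsDescendant j d ↔ F.IsDescendant j d := by
  refine ⟨IsDescendant.of_cut, fun h => ?_⟩
  induction h with
  | refl => exact Relation.ReflTransGen.refl
  | @tail b c hjb hbc ih =>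
    refine ih.tail (isChild_cut_iff.2 ⟨hbc, ?_⟩)
    rintro rfl
    have hb : b = v := Option.some_injective _ ((show F.parent c = some b from hbc).symm.trans hr)
    exact hj (IsDescendant.eq_of_parent_eq_none (hb ▸ hjb) hv)

theorem isDescendant_cut_self (hr : F.parent r = some v) (hv : F.parent v = none) {d : V} :
    (F.cut r).IsDescendant r d ↔ F.IsDescendant r d :=
  isDescendant_cut_iff hr hv fun h => by simp [h, hv] at hr

theorem numComponents_cut [Fintype V] (hr : F.parent r = some v) :
    (F.cut r).numComponents = F.numComponents + 1 := by
  classical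
  rw [numComponents, numComponents, ← Finset.card_insert_of_notMem (a := r) (by simp [hr])]
  congr 1
  ext i
  simp only [Finset.mem_filter, Finset.mem_univ, true_and, cut_parent_eq_none_iff,
    Finset.mem_insert]
  tauto

variable [LinearOrder V] {o : V}

/-- If the subtree cut off a root `v` contains a vertex `o < v`, then exactly one improper edge is
lost, and the status of the other edges does not change. -/
theorem isImproper_iff_cut (hr : F.parent r = some v) (hv : F.parent v = none)
    (hd : F.IsDescendant r o) (hov : o < v) {i j : V} :
    F.IsImproper i j ↔ (F.cut r).IsImproper i j ∨ (i = v ∧ j = r) := by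
  constructor
  · rintro ⟨hij, d, hjd, hdi⟩
    by_cases hj : j = r
    · subst hj
      exact Or.inr ⟨Option.some_injective _ ((show F.parent j = some i from hij).symm.trans hr),
        rfl⟩
    · refine Or.inl ⟨isChild_cut_iff.2 ⟨hij, hj⟩, d, ?_, hdi⟩
      refine (isDescendant_cut_iff hr hv ?_).2 hjd
      rintro rfl
      simp [IsChild, hv] at hij
  · rintro (⟨hij, d, hjd, hdi⟩ | ⟨rfl, rfl⟩)
    · exact ⟨(isChild_cut_iff.1 hij).1, d, hjd.of_cut, hdi⟩
    · exact ⟨hr, o, hd, hov⟩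

theorem isProperChild_iff_cut (hr : F.parent r = some v) (hv : F.parent v = none)
    (hd : F.IsDescendant r o) (hov : o < v) {i j : V} :
    F.IsProperChild i j ↔ (F.cut r).IsProperChild i j := by
  rw [IsProperChild, IsProperChild, isImproper_iff_cut hr hv hd hov, isChild_cut_iff]
  constructor
  · rintro ⟨h1, h2⟩
    refine ⟨⟨h1, ?_⟩, fun h => h2 (Or.inl h)⟩
    rintro rfl
    exact h2 (Or.inr ⟨Option.some_injective _ ((show F.parent j = some i from h1).symm.trans hr),
      rfl⟩)
  · rintro ⟨⟨h1, h3⟩, h2⟩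
    exact ⟨h1, fun h => h.elim h2 fun h => h3 h.2⟩

theorem weight_eq_mul_weight_cut [Fintype V] {S : Type*} [CommRing S] (y : S) (φ : ℕ → S)
    (hr : F.parent r = some v) (hv : F.parent v = none) (hd : F.IsDescendant r o) (hov : o < v) :
    F.weight y φ = y * (F.cut r).weight y φ := by
  classical
  have h1 : F.numImproper = (F.cut r).numImproper + 1 := by
    rw [numImproper, numImproper, ← Finset.card_insert_of_notMem (a := (v, r))]
    · congr 1
      ext ⟨i, j⟩
      simp only [Finset.mem_filter, Finset.mem_univ, true_and, Finset.mem_insert, Prod.mk.injEq,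
        isImproper_iff_cut hr hv hd hov]
      tauto
    · simp [IsImproper, isChild_cut_iff]
  have h2 : F.numProperChildren = (F.cut r).numProperChildren := by
    funext i
    simp only [numProperChildren, isProperChild_iff_cut hr hv hd hov]
  rw [weight, weight, h1, h2, pow_succ]
  ring

end Cut

open Classical in
/-- The number of roots other than that of the tree of `o`. -/
theorem card_roots_not_isDescendant {V : Type*} [Fintype V] (F : RootedForest V) (o : V) :
    (Finset.univ.filter fun v => F.parent v = none ∧ ¬ F.IsDescendant v o).card + 1 =
      F.numComponents := by
  obtain ⟨r, hr, hd⟩ := F.exists_root o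
  rw [numComponents, ← Finset.card_insert_of_notMem (a := r) (by simp [hd])]
  congr 1
  ext i
  simp only [Finset.mem_filter, Finset.mem_univ, true_and, Finset.mem_insert]
  constructor
  · rintro (rfl | h)
    · exact hr
    · exact h.1
  · intro h
    by_cases hi : F.IsDescendant i o
    · exact Or.inl (root_unique h hr hi hd)
    · exact Or.inr ⟨h, hi⟩

open Classical in
/-- Cutting the edge that leaves the root of the tree of the smallest vertex `o` towards `o` is a
bijection from the forests with `K` components in which `o` is not a root to the forests with
`K + 1` components together with one of the `K` roots of trees not containing `o`. -/
theorem sum_weight_of_parent_ne_none {V : Type*} [Fintype V] [LinearOrder V] {S : Type*}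
    [CommRing S] (y : S) (φ : ℕ → S) {o : V} (ho : ∀ v, o ≤ v) (K : ℕ) :
    ∑ F : RootedForest V with F.numComponents = K ∧ F.parent o ≠ none, F.weight y φ =
      y * K * ∑ F : RootedForest V with F.numComponents = K + 1, F.weight y φ := by
  have hV : Nonempty V := ⟨o⟩
  have hrhs : y * K * ∑ F : RootedForest V with F.numComponents = K + 1, F.weight y φ =
      ∑ p ∈ (Finset.univ.filter fun F : RootedForest V => F.numComponents = K + 1).sigma
        (fun F => Finset.univ.filter fun v => F.parent v = none ∧ ¬ F.IsDescendant v o),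
        y * p.1.weight y φ := by
    rw [Finset.sum_sigma, Finset.mul_sum]
    refine Finset.sum_congr rfl fun F hF => ?_
    have hcard := F.card_roots_not_isDescendant o
    rw [(Finset.mem_filter.1 hF).2, add_left_inj] at hcard
    change _ = ∑ v with F.parent v = none ∧ ¬ F.IsDescendant v o, y * F.weight y φ
    rw [Finset.sum_const, hcard, nsmul_eq_mul]
    ring
  rw [hrhs]
  have hex : ∀ F : RootedForest V, F.parent o ≠ none →
      ∃ v r, F.parent v = none ∧ F.parent r = some v ∧ F.IsDescendant r o :=
    fun F => F.exists_child_of_root o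
  choose! v r hv hr hd using hex
  have hov : ∀ F : RootedForest V, F.parent o ≠ none → o < v F := fun F hF =>
    lt_of_le_of_ne (ho _) fun h => hF (by rw [h]; exact hv F hF)
  refine Finset.sum_bij (fun F _ => ⟨F.cut (r F), v F⟩) ?_ ?_ ?_ ?_
  · intro F hF
    obtain ⟨hK, hF⟩ := (Finset.mem_filter.1 hF).2
    simp only [Finset.mem_sigma, Finset.mem_filter, Finset.mem_univ, true_and,
      numComponents_cut (hr F hF), hK, cut_parent_eq_none_iff, hv F hF, true_or]
    intro h
    have := root_unique (cut_parent_eq_none_iff.2 (Or.inl (hv F hF)))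
      (cut_parent_eq_none_iff.2 (Or.inr rfl)) h
      ((isDescendant_cut_self (hr F hF) (hv F hF)).2 (hd F hF))
    have h1 := hr F hF
    rw [← this, hv F hF] at h1
    simp at h1
  · intro F hF F' hF' h
    replace hF := (Finset.mem_filter.1 hF).2.2
    replace hF' := (Finset.mem_filter.1 hF').2.2
    obtain ⟨h1, h2⟩ := Sigma.mk.inj h
    replace h2 := eq_of_heq h2
    have hrr : r F = r F' := by
      refine root_unique (F := F.cut (r F)) (u := o) (cut_parent_eq_none_iff.2 (Or.inr rfl)) ?_
        ((isDescendant_cut_self (hr F hF) (hv F hF)).2 (hd F hF)) ?_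
      · rw [h1]
        exact cut_parent_eq_none_iff.2 (Or.inr rfl)
      · rw [h1]
        exact (isDescendant_cut_self (hr F' hF') (hv F' hF')).2 (hd F' hF')
    ext1
    funext i
    by_cases hi : i = r F
    · rw [hi, hr F hF, hrr, hr F' hF', h2]
    · have := congrFun (congrArg parent h1) i
      simpa [cut, Function.update_of_ne hi, Function.update_of_ne (hrr ▸ hi)] using this
  · rintro ⟨G, w⟩ hG
    simp only [Finset.mem_sigma, Finset.mem_filter, Finset.mem_univ, true_and] at hG
    obtain ⟨hK, hw, hwo⟩ := hG
    obtain ⟨s, hs, hso⟩ := G.exists_root o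
    have hsw : ¬ G.IsDescendant s w := fun h => hwo (h.eq_of_parent_eq_none hw ▸ hso)
    have hne : w ≠ s := fun h => hwo (h ▸ hso)
    set F := G.attach s w hs hsw with hFdef
    have hcut : F.cut s = G := cut_attach ..
    have hFs : F.parent s = some w := by simp [hFdef, attach]
    have hFw : F.parent w = none := by simp [hFdef, attach, Function.update_of_ne hne, hw]
    have hFso : F.IsDescendant s o := by
      rw [← isDescendant_cut_self hFs hFw, hcut]
      exact hso
    have hF : F.parent o ≠ none := fun h => by
      have := hFso.eq_of_parent_eq_none h
      rw [← this, hFs] at h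
      simp at h
    have hvw : v F = w := root_unique (hv F hF) hFw
      (Relation.ReflTransGen.head (hr F hF) (hd F hF)) (Relation.ReflTransGen.head hFs hFso)
    have hrs : r F = s := by
      have hne' : w ≠ r F := fun h => by
        have := hr F hF
        rw [← h, hFw] at this
        simp at this
      have hGo : G.IsDescendant (r F) o := by
        rw [← hcut]
        exact (isDescendant_cut_iff hFs hFw hne'.symm).2 (hd F hF)
      by_contra hrs
      -- otherwise the child `r F` of `w` in `F` would also be a child of `w` in `G`
      have hch : G.IsChild w (r F) := by
        rw [← hcut, isChild_cut_iff]
        exact ⟨(hr F hF).trans (by rw [hvw]), hrs⟩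
      exact hwo (Relation.ReflTransGen.head hch hGo)
    refine ⟨F, ?_, ?_⟩
    · simp only [Finset.mem_filter, Finset.mem_univ, true_and]
      refine ⟨?_, hF⟩
      have := numComponents_cut hFs
      rw [hcut, hK] at this
      omega
    · rw [hvw, hrs, hcut]
  · intro F hF
    replace hF := (Finset.mem_filter.1 hF).2.2
    exact weight_eq_mul_weight_cut y φ (hr F hF) (hv F hF) (hd F hF) (hov F hF)

end RootedForest

/-! ### Deleting the smallest vertex -/

namespace RootedForest

variable {n : ℕ}

/-- The forest obtained by deleting the vertex `0`; its children become roots. -/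
def deleteZero (F : RootedForest (Fin (n + 1))) : RootedForest (Fin n) where
  parent i := (F.parent i.succ).bind (Fin.cases none some)
  acyclic v h := by
    refine F.acyclic v.succ (Relation.TransGen.lift Fin.succ (fun i j hij => ?_) _ _ h)
    obtain ⟨p, hp, hpi⟩ := Option.bind_eq_some_iff.1 hij
    cases p using Fin.cases with
    | zero => simp at hpi
    | succ p =>
      obtain rfl : p = i := by simpa using hpi
      exact hp

/-- The forest obtained by adding a root `0` whose children are the vertices of `L`. -/
def addZero (F : RootedForest (Fin n)) (L : Finset (Fin n)) : RootedForest (Fin (n + 1)) where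
  parent := Fin.cases none fun i => if i ∈ L then some 0 else (F.parent i).map Fin.succ
  acyclic v h := by
    have key : ∀ a b : Fin (n + 1), Relation.TransGen (fun i j => (Fin.cases none (fun i =>
        if i ∈ L then some 0 else (F.parent i).map Fin.succ) j : Option (Fin (n + 1))) = some i)
        a b → ∀ a', a = Fin.succ a' → ∃ b', b = Fin.succ b' ∧ Relation.TransGen F.IsChild a' b' := by
      have edge : ∀ (a' : Fin n) (b : Fin (n + 1)), (Fin.cases none (fun i =>
          if i ∈ L then some 0 else (F.parent i).map Fin.succ) b : Option (Fin (n + 1))) =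
          some a'.succ → ∃ b', b = Fin.succ b' ∧ F.IsChild a' b' := by
        intro a' b hb
        cases b using Fin.cases with
        | zero => simp at hb
        | succ b =>
          refine ⟨b, rfl, ?_⟩
          simp only [Fin.cases_succ] at hb
          split_ifs at hb with hL
          · exact absurd (Option.some_injective _ hb).symm (Fin.succ_ne_zero _)
          · simpa [IsChild] using hb
      intro a b hab a' ha
      subst ha
      induction hab with
      | single h =>
        obtain ⟨b', rfl, hb'⟩ := edge a' _ h
        exact ⟨b', rfl, Relation.TransGen.single hb'⟩
      | tail _ h ih =>
        obtain ⟨b', rfl, hb'⟩ := ih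
        obtain ⟨c', rfl, hc'⟩ := edge b' _ h
        exact ⟨c', rfl, hb'.tail hc'⟩
    cases v using Fin.cases with
    | zero =>
      rcases Relation.TransGen.tail'_iff.1 h with ⟨b, -, hb⟩
      simp at hb
    | succ v =>
      obtain ⟨b', hb', hcyc⟩ := key _ _ h v rfl
      rw [← Fin.succ_injective _ hb'] at hcyc
      exact F.acyclic v hcyc

/-- The vertices that become roots when the vertex `0` is deleted. -/
def zeroChildren (F : RootedForest (Fin (n + 1))) : Finset (Fin n) :=
  Finset.univ.filter fun i => F.parent i.succ = some 0

variable {F : RootedForest (Fin (n + 1))}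

theorem isChild_deleteZero_iff {i j : Fin n} :
    F.deleteZero.IsChild i j ↔ F.IsChild i.succ j.succ := by
  simp only [IsChild, deleteZero, Option.bind_eq_some_iff]
  constructor
  · rintro ⟨p, hp, hpi⟩
    cases p using Fin.cases with
    | zero => simp at hpi
    | succ p =>
      obtain rfl : p = i := by simpa using hpi
      exact hp
  · intro h
    exact ⟨_, h, rfl⟩

theorem parent_deleteZero_eq_none_iff {i : Fin n} :
    F.deleteZero.parent i = none ↔ F.parent i.succ = none ∨ F.parent i.succ = some 0 := by
  simp only [deleteZero]
  rcases h : F.parent i.succ with _ | p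
  · simp
  · cases p using Fin.cases <;> simp

theorem isDescendant_succ_iff (h0 : F.parent 0 = none) {i : Fin n} {d : Fin (n + 1)} :
    F.IsDescendant i.succ d ↔ ∃ d', d = Fin.succ d' ∧ F.deleteZero.IsDescendant i d' := by
  constructor
  · intro h
    induction h with
    | refl => exact ⟨i, rfl, Relation.ReflTransGen.refl⟩
    | @tail b c _ hbc ih =>
      obtain ⟨b', rfl, hb'⟩ := ih
      cases c using Fin.cases with
      | zero => simp [IsChild, h0] at hbc
      | succ c => exact ⟨c, rfl, hb'.tail (isChild_deleteZero_iff.2 hbc)⟩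
  · rintro ⟨d', rfl, h⟩
    exact Relation.ReflTransGen.lift Fin.succ (fun _ _ h => isChild_deleteZero_iff.1 h) _ _ h

theorem isImproper_succ_iff (h0 : F.parent 0 = none) {i j : Fin n} :
    F.IsImproper i.succ j.succ ↔ F.deleteZero.IsImproper i j := by
  simp only [IsImproper, isChild_deleteZero_iff, isDescendant_succ_iff h0]
  refine and_congr_right fun _ => ⟨?_, ?_⟩
  · rintro ⟨_, ⟨d, rfl, hd⟩, hdi⟩
    exact ⟨d, hd, Fin.succ_lt_succ_iff.1 hdi⟩
  · rintro ⟨d, hd, hdi⟩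
    exact ⟨d.succ, ⟨d, rfl, hd⟩, Fin.succ_lt_succ_iff.2 hdi⟩

theorem numImproper_deleteZero (h0 : F.parent 0 = none) :
    F.deleteZero.numImproper = F.numImproper := by
  classical
  rw [numImproper, numImproper]
  refine Finset.card_bij (fun p _ => (p.1.succ, p.2.succ)) ?_ ?_ ?_
  · rintro ⟨i, j⟩ h
    simpa [isImproper_succ_iff h0] using h
  · rintro ⟨i, j⟩ _ ⟨i', j'⟩ _ h
    simpa using h
  · rintro ⟨i, j⟩ h
    simp only [Finset.mem_filter, Finset.mem_univ, true_and] at h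
    cases j using Fin.cases with
    | zero => simp [IsImproper, IsChild, h0] at h
    | succ j =>
      cases i using Fin.cases with
      | zero =>
        obtain ⟨-, d, -, hd⟩ := h
        exact absurd hd (Fin.not_lt_zero d)
      | succ i => exact ⟨(i, j), by simpa [isImproper_succ_iff h0] using h, rfl⟩

theorem numProperChildren_succ (h0 : F.parent 0 = none) (i : Fin n) :
    F.numProperChildren i.succ = F.deleteZero.numProperChildren i := by
  classical
  rw [numProperChildren, numProperChildren]
  symm
  refine Finset.card_bij (fun j _ => j.succ) ?_ ?_ ?_
  · intro j h
    simp only [Finset.mem_filter, Finset.mem_univ, true_and] at h ⊢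
    simpa [IsProperChild, isImproper_succ_iff h0, isChild_deleteZero_iff] using h
  · intro j _ j' _ h
    simpa using h
  · intro j h
    simp only [Finset.mem_filter, Finset.mem_univ, true_and] at h
    cases j using Fin.cases with
    | zero => simp [IsProperChild, IsChild, h0] at h
    | succ j =>
      exact ⟨j, by simpa [IsProperChild, isImproper_succ_iff h0, isChild_deleteZero_iff] using h,
        rfl⟩

theorem numProperChildren_zero (h0 : F.parent 0 = none) :
    F.numProperChildren 0 = F.zeroChildren.card := by
  classical
  rw [numProperChildren, zeroChildren]
  symm
  have himp : ∀ j, ¬ F.IsImproper 0 j := fun j ⟨_, d, _, hd⟩ => Fin.not_lt_zero d hd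
  refine Finset.card_bij (fun j _ => j.succ) ?_ ?_ ?_
  · intro j h
    simpa [IsProperChild, himp, IsChild] using h
  · intro j _ j' _ h
    simpa using h
  · intro j h
    simp only [Finset.mem_filter, Finset.mem_univ, true_and] at h
    cases j using Fin.cases with
    | zero => simp [IsProperChild, IsChild, h0] at h
    | succ j => exact ⟨j, by simpa [IsProperChild, himp, IsChild] using h, rfl⟩

theorem numComponents_add_card_zeroChildren (h0 : F.parent 0 = none) :
    F.numComponents + F.zeroChildren.card = F.deleteZero.numComponents + 1 := by
  classical
  simp only [numComponents, zeroChildren, Finset.card_filter, Fin.sum_univ_succ, h0, if_true,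
    parent_deleteZero_eq_none_iff]
  rw [add_comm 1, add_right_comm, ← Finset.sum_add_distrib]
  congr 1
  refine Finset.sum_congr rfl fun i _ => ?_
  rcases F.parent i.succ with _ | p
  · simp
  · simp

theorem weight_of_parent_zero_eq_none {S : Type*} [CommRing S] (y : S) (φ : ℕ → S)
    (h0 : F.parent 0 = none) :
    F.weight y φ = ((F.zeroChildren.card).factorial * φ F.zeroChildren.card) *
      F.deleteZero.weight y φ := by
  rw [weight, weight, Fin.prod_univ_succ, numProperChildren_zero h0, numImproper_deleteZero h0]
  simp only [numProperChildren_succ h0]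
  ring

theorem deleteZero_addZero (G : RootedForest (Fin n)) {L : Finset (Fin n)}
    (hL : ∀ i ∈ L, G.parent i = none) : (G.addZero L).deleteZero = G := by
  ext1
  funext i
  by_cases hi : i ∈ L
  · simp [deleteZero, addZero, hi, hL]
  · cases h : G.parent i <;> simp [deleteZero, addZero, hi, h]

theorem zeroChildren_addZero (G : RootedForest (Fin n)) (L : Finset (Fin n)) :
    (G.addZero L).zeroChildren = L := by
  ext i
  by_cases hi : i ∈ L <;> simp [zeroChildren, addZero, hi]

theorem addZero_deleteZero (h0 : F.parent 0 = none) :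
    F.deleteZero.addZero F.zeroChildren = F := by
  ext1
  funext i
  cases i using Fin.cases with
  | zero => simp [addZero, h0]
  | succ i =>
    rcases h : F.parent i.succ with _ | p
    · simp [addZero, deleteZero, zeroChildren, h]
    · cases p using Fin.cases <;> simp [addZero, deleteZero, zeroChildren, h]

open Classical in
/-- Forests on `{0, …, n}` in which `0` is a root correspond to forests on `n` vertices together
with a set `L` of roots of these, which become the children of `0`. All these children are
proper. -/
theorem sum_weight_of_parent_zero_eq_none {S : Type*} [CommRing S] (y : S) (φ : ℕ → S) (n k : ℕ) :
    ∑ F : RootedForest (Fin (n + 1)) with F.numComponents = k + 1 ∧ F.parent 0 = none,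
        F.weight y φ =
      ∑ G : RootedForest (Fin n), factorialToeplitz φ G.numComponents k * G.weight y φ := by
  have hsubsets : ∀ G : RootedForest (Fin n),
      factorialToeplitz φ G.numComponents k * G.weight y φ =
      ∑ L ∈ (Finset.univ.filter fun i => G.parent i = none).powerset with
        G.numComponents = k + L.card, ((L.card).factorial * φ L.card) * G.weight y φ := by
    intro G
    rw [← Finset.sum_mul, Finset.sum_filter, Finset.sum_powerset_apply_card
      (fun m => if G.numComponents = k + m then ((m.factorial : S) * φ m) else 0)]
    congr 1
    change factorialToeplitz φ G.numComponents k =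
      ∑ m ∈ Finset.range (G.numComponents + 1), (G.numComponents).choose m •
        (if G.numComponents = k + m then ((m.factorial : S) * φ m) else 0)
    rw [factorialToeplitz, Matrix.of_apply]
    split_ifs with h
    · rw [Finset.sum_eq_single (G.numComponents - k), if_pos (by omega),
        Nat.descFactorial_eq_factorial_mul_choose]
      · push_cast
        rw [nsmul_eq_mul]
        ring
      · intro m _ hm
        rw [if_neg (by omega), smul_zero]
      · intro hm
        exact absurd (Finset.mem_range.2 (by omega)) hm
    · rw [Finset.sum_eq_zero]
      intro m _
      rw [if_neg (by omega), smul_zero]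
  simp only [hsubsets]
  rw [Finset.sum_sigma']
  refine Finset.sum_bij' (fun F _ => ⟨F.deleteZero, F.zeroChildren⟩)
    (fun p _ => p.1.addZero p.2) ?_ ?_ ?_ ?_ ?_
  · intro F hF
    obtain ⟨hK, h0⟩ := (Finset.mem_filter.1 hF).2
    simp only [Finset.mem_sigma, Finset.mem_univ, Finset.mem_filter, Finset.mem_powerset, true_and]
    refine ⟨fun i hi => ?_, ?_⟩
    · simp only [Finset.mem_filter, Finset.mem_univ, true_and, parent_deleteZero_eq_none_iff]
      exact Or.inr (by simpa [zeroChildren] using hi)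
    · have := numComponents_add_card_zeroChildren h0
      omega
  · rintro ⟨G, L⟩ hG
    simp only [Finset.mem_sigma, Finset.mem_univ, Finset.mem_filter, Finset.mem_powerset,
      true_and] at hG
    have hL : ∀ i ∈ L, G.parent i = none := fun i hi => by simpa using hG.1 hi
    have h0 : (G.addZero L).parent 0 = none := rfl
    have := numComponents_add_card_zeroChildren h0
    rw [deleteZero_addZero G hL, zeroChildren_addZero] at this
    simp only [Finset.mem_filter, Finset.mem_univ, true_and]
    exact ⟨by omega, h0⟩
  · intro F hF
    exact addZero_deleteZero (Finset.mem_filter.1 hF).2.2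
  · rintro ⟨G, L⟩ hG
    simp only [Finset.mem_sigma, Finset.mem_univ, Finset.mem_filter, Finset.mem_powerset,
      true_and] at hG
    have hL : ∀ i ∈ L, G.parent i = none := fun i hi => by simpa using hG.1 hi
    simp only [deleteZero_addZero G hL, zeroChildren_addZero]
  · intro F hF
    exact weight_of_parent_zero_eq_none y φ (Finset.mem_filter.1 hF).2.2

theorem numComponents_le (F : RootedForest (Fin n)) : F.numComponents ≤ n := by
  classical
  rw [numComponents]
  exact (Finset.card_le_univ _).trans (Fintype.card_fin n).le

end RootedForest

/-! ### Recurrences for the rooted-forest polynomials -/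

section Recurrence

variable {S : Type*} [CommRing S] (y : S) (φ : ℕ → S)

open RootedForest

theorem rootedForestPoly_eq_zero {n k : ℕ} (h : n < k) : rootedForestPoly y φ n k = 0 := by
  classical
  rw [rootedForestPoly, Finset.filter_false_of_mem, Finset.sum_empty]
  intro F _ hF
  have := F.numComponents_le
  omega

theorem rootedForestPoly_succ_zero (n : ℕ) : rootedForestPoly y φ (n + 1) 0 = 0 := by
  classical
  rw [rootedForestPoly, Finset.filter_false_of_mem, Finset.sum_empty]
  intro F _ hF
  obtain ⟨r, hr, -⟩ := F.exists_root 0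
  rw [numComponents, Finset.card_eq_zero] at hF
  exact absurd (hF ▸ Finset.mem_filter.2 ⟨Finset.mem_univ r, hr⟩) (Finset.notMem_empty r)

theorem rootedForestPoly_zero_zero : rootedForestPoly y φ 0 0 = 1 := by
  classical
  let F₀ : RootedForest (Fin 0) := ⟨fun i => i.elim0, fun i => i.elim0⟩
  have huniq : ∀ F : RootedForest (Fin 0), F = F₀ := fun F => by
    ext1
    funext i
    exact i.elim0
  have hcomp : F₀.numComponents = 0 := Nat.le_zero.1 F₀.numComponents_le
  have himp : F₀.numImproper = 0 := by
    rw [numImproper, Finset.card_eq_zero]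
    exact Finset.filter_false_of_mem fun e => e.1.elim0
  rw [rootedForestPoly, Finset.sum_eq_single_of_mem F₀ (by simp [hcomp])
    fun F _ hF => absurd (huniq F) hF]
  simp [weight, himp]

theorem rootedForestPoly_succ_succ (n k : ℕ) :
    rootedForestPoly y φ (n + 1) (k + 1) =
      ∑ j ∈ Finset.range (n + 1), rootedForestPoly y φ n j * factorialToeplitz φ j k +
        y * (k + 1) * rootedForestPoly y φ (n + 1) (k + 2) := by
  classical
  have hsplit : rootedForestPoly y φ (n + 1) (k + 1) =
      ∑ F : RootedForest (Fin (n + 1)) with F.numComponents = k + 1 ∧ F.parent 0 = none,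
        F.weight y φ +
      ∑ F : RootedForest (Fin (n + 1)) with F.numComponents = k + 1 ∧ F.parent 0 ≠ none,
        F.weight y φ := by
    rw [rootedForestPoly, ← Finset.sum_filter_add_sum_filter_not _ fun F => F.parent 0 = none,
      Finset.filter_filter, Finset.filter_filter]
  have hfiber : ∑ G : RootedForest (Fin n), factorialToeplitz φ G.numComponents k * G.weight y φ =
      ∑ j ∈ Finset.range (n + 1), rootedForestPoly y φ n j * factorialToeplitz φ j k := by
    rw [← Finset.sum_fiberwise_of_maps_to (s := Finset.univ) (t := Finset.range (n + 1))
      (g := fun G : RootedForest (Fin n) => G.numComponents)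
      fun G _ => Finset.mem_range.2 (Nat.lt_succ_of_le G.numComponents_le)]
    refine Finset.sum_congr rfl fun j _ => ?_
    rw [rootedForestPoly, Finset.sum_mul]
    refine Finset.sum_congr (by congr!) fun G hG => ?_
    rw [(Finset.mem_filter.1 hG).2, mul_comm]
  rw [hsplit, ← hfiber]
  congr 1
  · convert sum_weight_of_parent_zero_eq_none y φ n k
  · have := sum_weight_of_parent_ne_none y φ (o := (0 : Fin (n + 1))) Fin.zero_le (k + 1)
    rw [Nat.cast_succ] at this
    rw [rootedForestPoly]
    convert this

/-- The exponential generating function `G` of trees satisfies `G' = Φ(G) / (1 - y G)` with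
`Φ(s) = ∑_m φ_m s^m`; this is the same fact for the triangle of coefficients of `G^k / k!`. -/
theorem isTriangle_rootedForestPoly :
    IsTriangle (geomConvolution y φ) (rootedForestPoly y φ) where
  row_zero k := by
    cases k with
    | zero => simp [rootedForestPoly_zero_zero]
    | succ k => simp [rootedForestPoly_eq_zero y φ (Nat.succ_pos k)]
  succ_zero := rootedForestPoly_succ_zero y φ
  succ_succ n := by
    have key : ∀ d k, n < k + d → rootedForestPoly y φ (n + 1) (k + 1) =
        ∑ j ∈ Finset.range (n + 1),
          rootedForestPoly y φ n j * factorialToeplitz (geomConvolution y φ) j k := by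
      intro d
      induction d with
      | zero =>
        intro k hk
        rw [rootedForestPoly_eq_zero y φ (show n + 1 < k + 1 by omega), Finset.sum_eq_zero]
        intro j hj
        rw [factorialToeplitz_eq_zero _ (by have := Finset.mem_range.1 hj; omega), mul_zero]
      | succ d ih =>
        intro k hk
        rw [rootedForestPoly_succ_succ, ih (k + 1) (by omega), Finset.mul_sum,
          ← Finset.sum_add_distrib]
        refine Finset.sum_congr rfl fun j _ => ?_
        rw [factorialToeplitz_geomConvolution y φ j k]
        ring
    exact fun k => key (n + 1) k (by omega)

end Recurrence

/-! ### Total positivity of the rooted-forest polynomials -/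

section Main

variable {S : Type*} [CommRing S] {P : RingCone S} {r : ℕ∞} {x y : S} {φ : ℕ → S}

theorem binomRowGenPoly_eq_coeff_taylor (x y : S) (φ : ℕ → S) (n k : ℕ) :
    binomRowGenPoly x y φ n k =
      (Polynomial.taylor x (rowPolynomial (rootedForestPoly y φ) n)).coeff k :=
  (coeff_taylor_rowPolynomial _ x n k).symm

theorem rowGenPoly_eq_coeff_taylor (x y : S) (φ : ℕ → S) (n : ℕ) :
    rowGenPoly x y φ n =
      (Polynomial.taylor x (rowPolynomial (rootedForestPoly y φ) n)).coeff 0 := by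
  rw [coeff_taylor_rowPolynomial]
  simp [rowGenPoly]

theorem isTPOfOrder_binomRowGenPoly (hx : x ∈ P) (hy : y ∈ P) (hφ : IsToeplitzTPOfOrder P r φ) :
    IsTPOfOrder P r (Matrix.of fun n k => binomRowGenPoly x y φ n k) := by
  simpa only [binomRowGenPoly_eq_coeff_taylor] using
    (isTriangle_rootedForestPoly y φ).isTPOfOrder_taylor (hφ.geomConvolution hy) hx

theorem isHankelTPOfOrder_rowGenPoly (hx : x ∈ P) (hy : y ∈ P)
    (hφ : IsToeplitzTPOfOrder P r φ) : IsHankelTPOfOrder P r fun n => rowGenPoly x y φ n := by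
  simpa only [rowGenPoly_eq_coeff_taylor] using
    (isTriangle_rootedForestPoly y φ).isHankelTPOfOrder_taylor (hφ.geomConvolution hy) hx

theorem isHankelTPOfOrder_rootedForestPoly_one (hr : 1 ≤ r) (hy : y ∈ P)
    (hφ : IsToeplitzTPOfOrder P r φ) :
    IsHankelTPOfOrder P r fun n => rootedForestPoly y φ (n + 1) 1 :=
  (isTriangle_rootedForestPoly y φ).isHankelTPOfOrder_column_one (hφ.geomConvolution hy)
    ((hφ.geomConvolution hy).zero_mem hr)

theorem IsToeplitzTPOfOrder.map {R : Type*} [CommRing R] {P' : RingCone R} {φ : ℕ → R}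
    (hφ : IsToeplitzTPOfOrder P' r φ) (f : R →+* S) (hf : ∀ a ∈ P', f a ∈ P) :
    IsToeplitzTPOfOrder P r fun m => f (φ m) := by
  intro s hs rows cols hrows hcols
  have : (toeplitzMatrix fun m => f (φ m)).submatrix rows cols =
      f.mapMatrix ((toeplitzMatrix φ).submatrix rows cols) := by
    ext i j
    simp only [toeplitzMatrix, Matrix.submatrix_apply, Matrix.of_apply, RingHom.mapMatrix_apply,
      Matrix.map_apply]
    split_ifs <;> simp
  rw [this, ← RingHom.map_det]
  exact hf _ (hφ s hs rows cols hrows hcols)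

end Main

section PolynomialCones

variable {R : Type*} [CommRing R] {P : RingCone R}

theorem RingCone.C_mem_polynomial {a : R} (ha : a ∈ P) : Polynomial.C a ∈ P.polynomial := by
  intro i
  rw [Polynomial.coeff_C]
  split_ifs
  · exact ha
  · exact zero_mem P

theorem RingCone.X_mem_polynomial : (Polynomial.X : Polynomial R) ∈ P.polynomial := by
  intro i
  rw [Polynomial.coeff_X]
  split_ifs
  · exact one_mem P
  · exact zero_mem P

theorem RingCone.C_mem_mvPolynomial {σ : Type*} {a : R} (ha : a ∈ P) :
    (MvPolynomial.C a : MvPolynomial σ R) ∈ P.mvPolynomial σ := by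
  classical
  intro d
  rw [MvPolynomial.coeff_C]
  split_ifs
  · exact ha
  · exact zero_mem P

theorem RingCone.X_mem_mvPolynomial {σ : Type*} (i : σ) :
    (MvPolynomial.X i : MvPolynomial σ R) ∈ P.mvPolynomial σ := by
  classical
  intro d
  rw [MvPolynomial.coeff_X]
  split_ifs
  · exact one_mem P
  · exact zero_mem P

end PolynomialCones

/-- In `R[x, y] = MvPolynomial (Fin 2) R` the indeterminate `x` is `X 0` and `y` is `X 1`;
in `R[y] = Polynomial R` the indeterminate `y` is `X`. -/
theorem theorem1p4 {R : Type*} [CommRing R] [Nontrivial R] (P : RingCone R)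
    (r : ℕ∞) (hr : 1 ≤ r) (φ : ℕ → R) (hφ : IsToeplitzTPOfOrder P r φ) :
    -- (a) the lower-triangular matrix `F(x, y, φ)` is coefficientwise TP of order `r`
    ((∀ n k : ℕ, n < k → binomRowGenPoly (MvPolynomial.X 0 : MvPolynomial (Fin 2) R)
        (MvPolynomial.X 1) (fun m => MvPolynomial.C (φ m)) n k = 0) ∧
      IsTPOfOrder (P.mvPolynomial (Fin 2)) r
        (Matrix.of fun n k : ℕ => binomRowGenPoly (MvPolynomial.X 0 : MvPolynomial (Fin 2) R)
          (MvPolynomial.X 1) (fun m => MvPolynomial.C (φ m)) n k)) ∧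
    -- (b) the sequence `F_n(x, y, φ)` is coefficientwise Hankel-TP of order `r`
    IsHankelTPOfOrder (P.mvPolynomial (Fin 2)) r
      (fun n : ℕ => rowGenPoly (MvPolynomial.X 0 : MvPolynomial (Fin 2) R)
        (MvPolynomial.X 1) (fun m => MvPolynomial.C (φ m)) n) ∧
    -- (c) the sequence `f_{n+1,1}(y, φ)` is coefficientwise Hankel-TP of order `r`
    IsHankelTPOfOrder P.polynomial r
      (fun n : ℕ => rootedForestPoly (Polynomial.X : Polynomial R)
        (fun m => Polynomial.C (φ m)) (n + 1) 1) := by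
  have hφ' : IsToeplitzTPOfOrder (P.mvPolynomial (Fin 2)) r fun m => MvPolynomial.C (φ m) :=
    hφ.map MvPolynomial.C fun _ => RingCone.C_mem_mvPolynomial
  have hx := RingCone.X_mem_mvPolynomial (P := P) (0 : Fin 2)
  have hy := RingCone.X_mem_mvPolynomial (P := P) (1 : Fin 2)
  refine ⟨⟨fun n k h => ?_, isTPOfOrder_binomRowGenPoly hx hy hφ'⟩,
    isHankelTPOfOrder_rowGenPoly hx hy hφ',
    isHankelTPOfOrder_rootedForestPoly_one hr RingCone.X_mem_polynomial
      (hφ.map Polynomial.C fun _ => RingCone.C_mem_polynomial)⟩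
  rw [binomRowGenPoly, Finset.Icc_eq_empty (by omega), Finset.sum_empty]
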